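/- Let $X$ be a Hausdorff locally convex topological vector space over $\mathbb{R}$, let $K\subseteq X$ be a nonempty compact convex set, and let $f:K\to K$ be a continuous mapping. If $f$ is not the identity mapping of $K$, then there is a point $p\in K$ such that $f$ has uncountably many different eigenvalues and eigenvectors with respect to $p$; that is, there exists an injective mapping $\lambda\mapsto x_\lambda$ from $(0,1]$ into $K$ such that \[ f(x_\lambda)=p+\frac{1}{\lambda}\,(x_\lambda-p)\qquad\text{for every }\lambda\in(0,1]. \] -/

import Mathlib

/-!
Choose `p` with `f p ≠ p`. The equation for `x t` says that `x t` is a fixed point of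
`x ↦ t • f x + (1 - t) • p`, a continuous self-map of `K`, so it is solvable by the
Schauder–Tychonoff theorem (`exists_fixedPoint_of_isCompact_convex`). If `x s = x t` with `s ≠ t`,
then comparing the two equations gives `f (x s) = p = x s`, contrary to the choice of `p`.

Schauder–Tychonoff is reduced to Brouwer's theorem on a standard simplex
(`stdSimplex.exists_fixedPoint`) by a partition of unity, see `exists_sub_mem_of_convex`. Brouwer's
theorem is proved combinatorially, with Scarf's dominant sets in place of triangulations. A finite
set `X` is given one linear order for each index `i ∈ I`. The dominant pairs `(σ, C)` with
`#σ = #C` (rooms) and those with `#C = #σ + 1` (doors) behave like the top simplices and the facets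
of a pseudomanifold: a door belongs to two rooms, or to one if it lies on the boundary
(`IsDominant.card_rooms_of_nonempty`, `IsDominant.card_rooms_empty`). The parity argument of
Sperner's lemma then yields a room coloured exactly by its own index set
(`IsDominant.exists_image_eq`). For the lattice points of a dilated simplex, ordered by their
coordinates, the points of a room are close to each other, while the coordinates outside `C` are
small (`exists_natPoints`). Colouring a point `x` by a coordinate with `x i ≤ f x i` and passing to
the limit produces a point none of whose coordinates is decreased by `f`, that is, a fixed point.
-/

/-! ### Dominant sets for a family of linear orders -/

open Finset in
/-- A door `(τ, D)` of a room `(σ, C)` arises either by adding an index to `C` or by deleting a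
point from `σ`, but not both. -/
theorem Finset.eq_or_eq_of_card_facet {X I : Type*} [DecidableEq X] [DecidableEq I]
    {τ σ : Finset X} {C D : Finset I} (hτ : τ ⊆ σ) (hC : C ⊆ D)
    (hD : #D = #τ + 1) (hσ : #σ = #C) :
    (σ = τ ∧ ∃ k ∈ D, C = D.erase k) ∨ (C = D ∧ ∃ y ∉ τ, σ = insert y τ) := by
  have h1 := card_le_card hτ
  have h2 := card_le_card hC
  by_cases h : #σ = #τ
  · left
    have hst : σ = τ := (eq_of_subset_of_card_le hτ h.le).symm
    refine ⟨hst, ?_⟩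
    obtain ⟨k, hk⟩ : ∃ k, k ∈ D \ C := by
      rw [← Finset.Nonempty, ← card_pos, card_sdiff_of_subset hC]; omega
    rw [mem_sdiff] at hk
    refine ⟨k, hk.1, eq_of_subset_of_card_le (fun i hi => mem_erase.2 ⟨?_, hC hi⟩) ?_⟩
    · rintro rfl; exact hk.2 hi
    · rw [card_erase_of_mem hk.1]; omega
  · right
    refine ⟨eq_of_subset_of_card_le hC (by omega), ?_⟩
    obtain ⟨y, hy⟩ : ∃ y, y ∈ σ \ τ := by
      rw [← Finset.Nonempty, ← card_pos, card_sdiff_of_subset hτ]; omega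
    rw [mem_sdiff] at hy
    refine ⟨y, hy.2, (eq_of_subset_of_card_le (insert_subset hy.1 hτ) ?_).symm⟩
    rw [card_insert_of_notMem hy.2]; omega

/-- A family of functions `u i` compares the points of `X` in several ways. The pair `(σ, C)` is
*dominant* if no point of `X` lies strictly above the `u i`-minimum of `σ` for all `i ∈ C`
simultaneously. A dominant pair is called a *room* if `#σ = #C`, and a *door* if `#C = #σ + 1`. -/
def IsDominant {X I α : Type*} [LinearOrder α] (u : I → X → α) (σ : Finset X) (C : Finset I) :
    Prop :=
  ∀ y, ∃ i ∈ C, ∀ x ∈ σ, u i y ≤ u i x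

namespace IsDominant

open Finset

variable {X I α : Type*} [LinearOrder α] {u : I → X → α}

theorem mono {τ σ : Finset X} {C D : Finset I} (h : IsDominant u σ C) (hτ : τ ⊆ σ) (hC : C ⊆ D) :
    IsDominant u τ D := fun y =>
  let ⟨i, hi, hy⟩ := h y
  ⟨i, hC hi, fun x hx => hy x (hτ hx)⟩

variable [DecidableEq X] [DecidableEq I]

/-- A dominant pair `(τ, D)` extends in exactly one way in the direction `k`, either by deleting
`k` from `D` or by adding to `τ` a point that is `u k`-below all of `τ`, as soon as the
`u l`-minimizers `m l` for `l ∈ D.erase k` enumerate `τ` without repetition. -/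
theorem existsUnique_room [Finite X] (hu : ∀ i, Function.Injective (u i))
    {τ : Finset X} {D : Finset I} (h : IsDominant u τ D) (hcard : #D = #τ + 1) {k : I} (hk : k ∈ D)
    {m : I → X} (hmin : ∀ l ∈ D.erase k, ∀ x ∈ τ, u l (m l) ≤ u l x)
    (hinj : Set.InjOn m (D.erase k)) (himg : (D.erase k).image m = τ) :
    ∃! R : Finset X × Finset I, (IsDominant u R.1 R.2 ∧ #R.1 = #R.2 ∧ τ ⊆ R.1 ∧ R.2 ⊆ D) ∧
      (k ∉ R.2 ∨ ∃ y ∈ R.1, ∀ x ∈ τ, u k y < u k x) := by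
  have hm : ∀ l ∈ D.erase k, m l ∈ τ := fun l hl => himg ▸ mem_image_of_mem m hl
  -- An added point cannot replace the minimum in a direction other than `k`.
  have key : ∀ y, IsDominant u (insert y τ) D → (∀ x ∈ τ, u k y < u k x) →
      ∀ l ∈ D.erase k, u l (m l) < u l y := by
    intro y hy hky l hl
    by_contra! hly
    obtain ⟨l', hl', hx⟩ := hy (m l)
    have hl'k : l' ≠ k := by
      rintro rfl
      exact (hx y (mem_insert_self _ _)).not_gt (hky _ (hm l hl))
    have hl'D : l' ∈ D.erase k := mem_erase.2 ⟨hl'k, hl'⟩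
    have e : m l = m l' := hu l' (le_antisymm (hx _ (mem_insert_of_mem (hm l' hl'D)))
      (hmin l' hl'D _ (hm l hl)))
    have e2 := hinj hl hl'D e
    subst e2
    have e3 : y = m l := hu l (le_antisymm hly (hx y (mem_insert_self _ _)))
    exact (hky _ (hm l hl)).ne (by rw [← e3])
  have hcases : ∀ R : Finset X × Finset I, ((IsDominant u R.1 R.2 ∧ #R.1 = #R.2 ∧ τ ⊆ R.1 ∧
      R.2 ⊆ D) ∧ (k ∉ R.2 ∨ ∃ y ∈ R.1, ∀ x ∈ τ, u k y < u k x)) →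
      (IsDominant u τ (D.erase k) ∧ R = (τ, D.erase k)) ∨
      ∃ y, R = (insert y τ, D) ∧ IsDominant u (insert y τ) D ∧ ∀ x ∈ τ, u k y < u k x := by
    rintro ⟨σ, C⟩ ⟨⟨hdom, hσC, hτσ, hCD⟩, hR⟩
    dsimp only at *
    rcases eq_or_eq_of_card_facet hτσ hCD hcard hσC with ⟨rfl, j, hj, rfl⟩ | ⟨rfl, y, hy, rfl⟩
    · left
      rcases hR with hR | ⟨y, hy, hy'⟩
      · have : k = j := by by_contra hne; exact hR (mem_erase.2 ⟨hne, hk⟩)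
        subst this
        exact ⟨hdom, rfl⟩
      · exact absurd (hy' y hy) (lt_irrefl _)
    · right
      refine ⟨y, rfl, hdom, ?_⟩
      rcases hR with hR | ⟨z, hz, hz'⟩
      · exact absurd hk hR
      · rcases mem_insert.1 hz with rfl | hz
        · exact hz'
        · exact absurd (hz' z hz) (lt_irrefl _)
  by_cases hdom : IsDominant u τ (D.erase k)
  · refine ⟨(τ, D.erase k), ⟨⟨hdom, ?_, Subset.rfl, erase_subset _ _⟩, Or.inl (by simp)⟩, ?_⟩
    · simp [card_erase_of_mem hk, hcard]
    · intro R hR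
      rcases hcases R hR with ⟨-, h⟩ | ⟨y, -, hy, hky⟩
      · exact h
      · obtain ⟨l, hl, hly⟩ := hdom y
        exact absurd (hly _ (hm l hl)) (key y hy hky l hl).not_ge
  · -- The new vertex is the `u k`-largest point not dominated by the directions in `D.erase k`.
    obtain ⟨y, hyU, hymax⟩ : ∃ y, (∀ l ∈ D.erase k, u l (m l) < u l y) ∧
        ∀ z, (∀ l ∈ D.erase k, u l (m l) < u l z) → u k z ≤ u k y := by
      have hne : {y | ∀ l ∈ D.erase k, u l (m l) < u l y}.Nonempty := by
        unfold IsDominant at hdom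
        push Not at hdom
        obtain ⟨y, hy⟩ := hdom
        refine ⟨y, fun l hl => ?_⟩
        obtain ⟨x, hx, hxy⟩ := hy l hl
        exact (hmin l hl x hx).trans_lt hxy
      obtain ⟨y, hy, hmax⟩ := Set.exists_max_image _ (u k) (Set.toFinite _) hne
      exact ⟨y, hy, hmax⟩
    have hyτ : y ∉ τ := by
      intro hy
      rw [← himg] at hy
      obtain ⟨l, hl, rfl⟩ := mem_image.1 hy
      exact (hyU l hl).false
    have hky : ∀ x ∈ τ, u k y < u k x := by
      obtain ⟨l, hl, hly⟩ := h y
      have : l = k := by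
        by_contra hne
        have hl' : l ∈ D.erase k := mem_erase.2 ⟨hne, hl⟩
        exact (hly _ (hm l hl')).not_gt (hyU l hl')
      subst this
      intro x hx
      refine lt_of_le_of_ne (hly x hx) fun e => hyτ ?_
      rwa [hu _ e]
    refine ⟨(insert y τ, D), ⟨⟨?_, ?_, subset_insert _ _, Subset.rfl⟩,
      Or.inr ⟨y, mem_insert_self _ _, hky⟩⟩, ?_⟩
    · intro z
      by_cases hz : ∀ l ∈ D.erase k, u l (m l) < u l z
      · refine ⟨k, hk, fun x hx => (hymax z hz).trans ?_⟩
        rcases mem_insert.1 hx with rfl | hx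
        · exact le_rfl
        · exact (hky x hx).le
      · push Not at hz
        obtain ⟨l, hl, hlz⟩ := hz
        refine ⟨l, mem_of_mem_erase hl, fun x hx => hlz.trans ?_⟩
        rcases mem_insert.1 hx with rfl | hx
        · exact (hyU l hl).le
        · exact hmin l hl x hx
    · simp [card_insert_of_notMem hyτ, hcard]
    · intro R hR
      rcases hcases R hR with ⟨h, -⟩ | ⟨z, rfl, hz, hkz⟩
      · exact absurd h hdom
      · have h1 := hymax z (key z hz hkz)
        obtain ⟨l, hl, hly⟩ := hz y
        have : l = k := by
          by_contra hne
          have hl' : l ∈ D.erase k := mem_erase.2 ⟨hne, hl⟩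
          exact (hly _ (mem_insert_of_mem (hm l hl'))).not_gt (hyU l hl')
        subst this
        rw [hu _ (le_antisymm h1 (hly z (mem_insert_self _ _)))]

open scoped Classical in
/-- The rooms adjacent to the door `(τ, D)`: the dominant pairs `(σ, C)` with `#σ = #C` and
`τ ⊆ σ`, `C ⊆ D`. -/
noncomputable def rooms [Fintype X] [Fintype I] (u : I → X → α) (τ : Finset X) (D : Finset I) :
    Finset (Finset X × Finset I) :=
  {R | IsDominant u R.1 R.2 ∧ #R.1 = #R.2 ∧ τ ⊆ R.1 ∧ R.2 ⊆ D}

theorem mem_rooms [Fintype X] [Fintype I] {τ : Finset X} {D : Finset I}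
    {R : Finset X × Finset I} : R ∈ rooms u τ D ↔
      IsDominant u R.1 R.2 ∧ #R.1 = #R.2 ∧ τ ⊆ R.1 ∧ R.2 ⊆ D := by
  simp [rooms]

/-- A door whose set of points is empty lies on the boundary: it belongs to a single room. -/
theorem card_rooms_empty [Fintype X] [Fintype I] [Nonempty X]
    (hu : ∀ i, Function.Injective (u i)) (k : I) :
    #(rooms u ∅ {k}) = 1 := by
  have h : IsDominant u ∅ {k} := fun y => ⟨k, by simp, by simp⟩
  obtain ⟨R, hR, huniq⟩ := existsUnique_room hu h (by simp) (mem_singleton_self k)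
    (m := fun _ => Classical.arbitrary X) (by simp) (by simp) (by simp)
  refine card_eq_one.2 ⟨R, ?_⟩
  ext Q
  rw [mem_singleton, mem_rooms]
  refine ⟨fun hQ => huniq Q ⟨hQ, ?_⟩, fun hQ => hQ ▸ hR.1⟩
  rcases Q.1.eq_empty_or_nonempty with he | ⟨y, hy⟩
  · left
    have := hQ.2.1
    rw [he, card_empty, eq_comm, card_eq_zero] at this
    simp [this]
  · exact Or.inr ⟨y, hy, by simp⟩

/-- Every other door belongs to exactly two rooms. The `u i`-minimizers of `τ`, for `i ∈ D`, cover
`τ`, so exactly two indices of `D` share a minimizer, and each of these two gives one room. -/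
theorem card_rooms_of_nonempty [Fintype X] [Fintype I]
    (hu : ∀ i, Function.Injective (u i)) {τ : Finset X} {D : Finset I} (h : IsDominant u τ D)
    (hcard : #D = #τ + 1) (hτ : τ.Nonempty) : #(rooms u τ D) = 2 := by
  choose m hmem hmin using fun i => τ.exists_min_image (u i) hτ
  have huniq : ∀ (i : I) (x : X), x ∈ τ → (∀ z ∈ τ, u i x ≤ u i z) → x = m i := fun i x hx hz =>
    hu i (le_antisymm (hz _ (hmem i)) (hmin i x hx))
  obtain ⟨i, hi, j, hj, hij, hmij⟩ := exists_ne_map_eq_of_card_lt_of_maps_to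
    (show #τ < #D by omega) (f := m) (fun l _ => hmem l)
  have hsurj : ∀ x ∈ τ, ∃ l ∈ D, x = m l := fun x hx =>
    let ⟨l, hl, hx'⟩ := h x
    ⟨l, hl, huniq l x hx hx'⟩
  -- Deleting either of the two indices that share a minimizer leaves an enumeration of `τ`.
  have himg : ∀ a ∈ D, ∀ b ∈ D, a ≠ b → m a = m b → (D.erase a).image m = τ := by
    intro a ha b hb hab hmab
    ext x
    refine ⟨fun hx => ?_, fun hx => ?_⟩
    · obtain ⟨l, -, rfl⟩ := mem_image.1 hx
      exact hmem l
    · obtain ⟨l, hl, rfl⟩ := hsurj x hx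
      by_cases hla : l = a
      · subst hla
        exact hmab ▸ mem_image_of_mem m (mem_erase.2 ⟨hab.symm, hb⟩)
      · exact mem_image_of_mem m (mem_erase.2 ⟨hla, hl⟩)
  have hinj : ∀ a ∈ D, ∀ b ∈ D, a ≠ b → m a = m b → Set.InjOn m (D.erase a) := by
    intro a ha b hb hab hmab
    rw [← card_image_iff, himg a ha b hb hab hmab, card_erase_of_mem ha, hcard]
    rfl
  have himi := himg i hi j hj hij hmij
  have himj := himg j hj i hi hij.symm hmij.symm
  have hini := hinj i hi j hj hij hmij
  have hinjj := hinj j hj i hi hij.symm hmij.symm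
  -- `i` and `j` are the only two indices of `D` sharing a minimizer.
  have hpair : ∀ a ∈ D, ∀ b ∈ D, a ≠ b → m a = m b → (a = i ∧ b = j) ∨ (a = j ∧ b = i) := by
    intro a ha b hb hab hmab
    have h1 : a = i ∨ b = i := by
      by_contra! hc
      exact hab (hini (by simp [hc.1, ha]) (by simp [hc.2, hb]) hmab)
    have h2 : a = j ∨ b = j := by
      by_contra! hc
      exact hab (hinjj (by simp [hc.1, ha]) (by simp [hc.2, hb]) hmab)
    grind
  obtain ⟨Ri, hRi, hRi'⟩ := existsUnique_room hu h hcard hi (fun l _ => hmin l) hini himi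
  obtain ⟨Rj, hRj, hRj'⟩ := existsUnique_room hu h hcard hj (fun l _ => hmin l) hinjj himj
  -- Every adjacent room lies in exactly one of the two directions `i` and `j`.
  have hdir : ∀ R ∈ rooms u τ D,
      ((i ∉ R.2 ∨ ∃ y ∈ R.1, ∀ x ∈ τ, u i y < u i x) ∨
        (j ∉ R.2 ∨ ∃ y ∈ R.1, ∀ x ∈ τ, u j y < u j x)) ∧
      ¬ ((i ∉ R.2 ∨ ∃ y ∈ R.1, ∀ x ∈ τ, u i y < u i x) ∧
        (j ∉ R.2 ∨ ∃ y ∈ R.1, ∀ x ∈ τ, u j y < u j x)) := by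
    rintro ⟨σ, C⟩ hR
    obtain ⟨hdom, hσC, hτσ, hCD⟩ := mem_rooms.1 hR
    dsimp only at *
    rcases eq_or_eq_of_card_facet hτσ hCD hcard hσC with ⟨rfl, k, hk, rfl⟩ | ⟨rfl, y, hy, rfl⟩
    · have hk' : k = i ∨ k = j := by
        obtain ⟨l, hl, hl'⟩ := hdom (m k)
        have := hpair k hk l (mem_of_mem_erase hl) (ne_of_mem_erase hl).symm
          (huniq l _ (hmem k) hl')
        tauto
      have hno : ∀ l, ¬ ∃ y ∈ σ, ∀ x ∈ σ, u l y < u l x := fun l ⟨y, hy, hy'⟩ => (hy' y hy).false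
      simp only [hno, or_false, mem_erase, hi, hj]
      rcases hk' with rfl | rfl <;> simp [hij, hij.symm]
    · have hex : ∀ l, (∃ z ∈ insert y τ, ∀ x ∈ τ, u l z < u l x) ↔ ∀ x ∈ τ, u l y < u l x := by
        intro l
        refine ⟨?_, fun h => ⟨y, mem_insert_self _ _, h⟩⟩
        rintro ⟨z, hz, hz'⟩
        rcases mem_insert.1 hz with rfl | hz
        · exact hz'
        · exact absurd (hz' z hz) (lt_irrefl _)
      have hpart : ∀ k ∈ C, (∀ x ∈ τ, u k y < u k x) →
          ∃ l ∈ C, k ≠ l ∧ m k = m l ∧ ¬ ∀ x ∈ τ, u l y < u l x := by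
        intro k hk hky
        obtain ⟨l, hl, hl'⟩ := hdom (m k)
        have hly := hl' y (mem_insert_self _ _)
        refine ⟨l, hl, ?_, huniq l _ (hmem k) fun z hz => hl' z (mem_insert_of_mem hz),
          fun hc => (hc _ (hmem k)).not_ge hly⟩
        rintro rfl
        exact (hky _ (hmem k)).not_ge hly
      obtain ⟨k, hk, hky⟩ := hdom y
      have hky' : ∀ x ∈ τ, u k y < u k x := fun x hx =>
        lt_of_le_of_ne (hky x (mem_insert_of_mem hx)) fun e => hy (hu k e ▸ hx)
      obtain ⟨l, hl, hkl, hmkl, hly⟩ := hpart k hk hky'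
      simp only [hex, hi, hj, not_true, false_or]
      rcases hpair k hk l hl hkl hmkl with ⟨rfl, rfl⟩ | ⟨rfl, rfl⟩ <;> tauto
  refine card_eq_two.2 ⟨Ri, Rj, ?_, ?_⟩
  · rintro rfl
    exact (hdir Ri (mem_rooms.2 hRi.1)).2 ⟨hRi.2, hRj.2⟩
  · ext Q
    rw [mem_insert, mem_singleton]
    refine ⟨fun hQ => ?_, ?_⟩
    · rcases (hdir Q hQ).1 with h' | h'
      · exact Or.inl (hRi' Q ⟨mem_rooms.1 hQ, h'⟩)
      · exact Or.inr (hRj' Q ⟨mem_rooms.1 hQ, h'⟩)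
    · rintro (rfl | rfl)
      exacts [mem_rooms.2 hRi.1, mem_rooms.2 hRj.1]

end IsDominant

/-! ### A Sperner lemma -/

open Finset in
/-- A room `(σ, C)` whose set of colours is not `C` has an even number (zero or two) of doors
`(τ, D)` that carry every colour of `D` except `i₀`. -/
theorem even_card_doors {X I : Type*} [Fintype X] [Fintype I] [DecidableEq X] [DecidableEq I]
    (c : X → I) (i₀ : I) {σ : Finset X} {C : Finset I} (hcard : #σ = #C) (hne : σ.image c ≠ C) :
    Even #{d : Finset X × Finset I | (#d.2 = #d.1 + 1 ∧ i₀ ∈ d.2 ∧ d.1.image c = d.2.erase i₀) ∧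
      d.1 ⊆ σ ∧ C ⊆ d.2} := by
  have hinj : ∀ (τ : Finset X) (D : Finset I), #D = #τ + 1 → i₀ ∈ D → τ.image c = D.erase i₀ →
      Set.InjOn c τ := by
    intro τ D h1 h2 h3
    rw [← card_image_iff, h3, card_erase_of_mem h2, h1]
    rfl
  by_cases hx : ∃ x ∈ σ, i₀ ∈ C ∧ (σ.erase x).image c = C.erase i₀
  · obtain ⟨x, hx, hi₀, himg⟩ := hx
    have hcx : c x ≠ i₀ := by
      intro hcx
      apply hne
      rw [← insert_erase hx, image_insert, himg, hcx, insert_erase hi₀]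
    have hσ : #σ = #(σ.erase x) + 1 := (card_erase_add_one hx).symm
    refine (show #_ = 2 from ?_) ▸ even_two
    -- The second door deletes the other point of colour `c x` if there is one, and otherwise adds
    -- the index `c x` to `C`.
    by_cases hxC : c x ∈ C
    · obtain ⟨x', hx', hcx'⟩ : ∃ x' ∈ σ.erase x, c x' = c x := by
        rw [← mem_image, himg]
        exact mem_erase.2 ⟨hcx, hxC⟩
      have hxx' : x' ≠ x := ne_of_mem_erase hx'
      have hx'σ := mem_of_mem_erase hx'
      have himg' : (σ.erase x').image c = C.erase i₀ := by
        rw [← himg]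
        ext j
        simp only [mem_image, mem_erase]
        constructor
        · rintro ⟨z, ⟨hz, hzσ⟩, rfl⟩
          by_cases hzx : z = x
          · exact ⟨x', ⟨hxx', hx'σ⟩, hzx ▸ hcx'⟩
          · exact ⟨z, ⟨hzx, hzσ⟩, rfl⟩
        · rintro ⟨z, ⟨hz, hzσ⟩, rfl⟩
          by_cases hzx : z = x'
          · exact ⟨x, ⟨hxx'.symm, hx⟩, hzx ▸ hcx'.symm⟩
          · exact ⟨z, ⟨hzx, hzσ⟩, rfl⟩
      refine card_eq_two.2 ⟨(σ.erase x, C), (σ.erase x', C), ?_, ?_⟩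
      · intro h
        have h1 := congrArg Prod.fst h
        dsimp only at h1
        exact notMem_erase x' σ (h1 ▸ hx')
      · ext ⟨τ, D⟩
        simp only [mem_filter, mem_univ, true_and, mem_insert, mem_singleton, Prod.mk.injEq]
        constructor
        · rintro ⟨⟨h1, h2, h3⟩, h4, h5⟩
          have h6 := hinj τ D h1 h2 h3
          rcases Finset.eq_or_eq_of_card_facet h4 h5 h1 hcard with
            ⟨rfl, k, hk, rfl⟩ | ⟨rfl, y, hy, rfl⟩
          · exact absurd (h6 hx'σ hx hcx') hxx'
          · have : y = x ∨ y = x' := by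
              by_contra! hc
              exact hxx' (h6 (mem_of_mem_insert_of_ne hx'σ hc.2.symm)
                (mem_of_mem_insert_of_ne hx hc.1.symm) hcx')
            rcases this with rfl | rfl <;> simp [hy]
        · rintro (⟨rfl, rfl⟩ | ⟨rfl, rfl⟩)
          · exact ⟨⟨by omega, hi₀, himg⟩, erase_subset _ _, Subset.rfl⟩
          · exact ⟨⟨by rw [card_erase_add_one hx'σ, hcard], hi₀, himg'⟩, erase_subset _ _,
              Subset.rfl⟩
    · refine card_eq_two.2 ⟨(σ.erase x, C), (σ, insert (c x) C), ?_, ?_⟩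
      · intro h
        have h1 := congrArg Prod.fst h
        dsimp only at h1
        exact erase_ne_self.2 hx h1
      · ext ⟨τ, D⟩
        simp only [mem_filter, mem_univ, true_and, mem_insert, mem_singleton, Prod.mk.injEq]
        constructor
        · rintro ⟨⟨h1, h2, h3⟩, h4, h5⟩
          rcases Finset.eq_or_eq_of_card_facet h4 h5 h1 hcard with
            ⟨rfl, k, hk, rfl⟩ | ⟨rfl, y, hy, rfl⟩
          · right
            have h6 : c x ∈ D.erase i₀ := h3 ▸ mem_image_of_mem c hx
            have h7 : c x = k := by
              by_contra hc
              exact hxC (mem_erase.2 ⟨hc, mem_of_mem_erase h6⟩)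
            exact ⟨rfl, by rw [h7, insert_erase hk]⟩
          · left
            have : x = y := by
              by_contra hc
              have h6 : c x ∈ C.erase i₀ := h3 ▸ mem_image_of_mem c (mem_of_mem_insert_of_ne hx hc)
              exact hxC (mem_of_mem_erase h6)
            subst this
            simp [hy]
        · rintro (⟨rfl, rfl⟩ | ⟨rfl, rfl⟩)
          · exact ⟨⟨by omega, hi₀, himg⟩, erase_subset _ _, Subset.rfl⟩
          · refine ⟨⟨by rw [card_insert_of_notMem hxC, hcard], mem_insert_of_mem hi₀, ?_⟩,
              Subset.rfl, subset_insert _ _⟩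
            rw [erase_insert_of_ne hcx, ← himg, ← image_insert, insert_erase hx]
  · refine (show #_ = 0 from ?_) ▸ Even.zero
    rw [card_eq_zero, filter_eq_empty_iff]
    rintro ⟨τ, D⟩ - ⟨⟨h1, h2, h3⟩, h4, h5⟩
    dsimp only at *
    apply hx
    rcases Finset.eq_or_eq_of_card_facet h4 h5 h1 hcard with ⟨rfl, k, hk, rfl⟩ | ⟨rfl, y, hy, rfl⟩
    · have hki : k ≠ i₀ := by
        rintro rfl
        exact hne h3
      obtain ⟨x, hx, hcx⟩ : ∃ x ∈ σ, c x = k := by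
        rw [← mem_image, h3]
        exact mem_erase.2 ⟨hki, hk⟩
      refine ⟨x, hx, mem_erase.2 ⟨hki.symm, h2⟩, ?_⟩
      have h6 := hinj _ _ h1 h2 h3
      rw [erase_right_comm, ← h3, ← hcx]
      ext j
      simp only [mem_image, mem_erase]
      constructor
      · rintro ⟨z, ⟨hz, hzσ⟩, rfl⟩
        exact ⟨fun e => hz (h6 hzσ hx e), z, hzσ, rfl⟩
      · rintro ⟨hj, z, hz, rfl⟩
        exact ⟨z, ⟨fun e => hj (e ▸ rfl), hz⟩, rfl⟩
    · exact ⟨y, mem_insert_self _ _, h2, by rwa [erase_insert hy]⟩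

open Finset in
/-- **Sperner's lemma for dominant sets.** Incidences of rooms with the doors `(τ, D)` that carry
every colour of `D` except `i₀` are counted in two ways: exactly one of these doors, `(∅, {i₀})`,
belongs to an odd number of rooms, so some room has an odd number of such doors. -/
theorem IsDominant.exists_image_eq {X I α : Type*} [LinearOrder α] [Finite X] [Finite I]
    [Nonempty X] [Nonempty I] [DecidableEq I] {u : I → X → α} (hu : ∀ i, Function.Injective (u i))
    (c : X → I) : ∃ (σ : Finset X) (C : Finset I),
      IsDominant u σ C ∧ #σ = #C ∧ σ.image c = C := by
  classical
  have := Fintype.ofFinite X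
  have := Fintype.ofFinite I
  obtain ⟨i₀⟩ := ‹Nonempty I›
  by_contra! hcon
  set S : Finset (Finset X × Finset I) := {R | IsDominant u R.1 R.2 ∧ #R.1 = #R.2}
  set T : Finset (Finset X × Finset I) := {d | IsDominant u d.1 d.2 ∧ #d.2 = #d.1 + 1 ∧
    i₀ ∈ d.2 ∧ d.1.image c = d.2.erase i₀} with hT
  have hcount := sum_card_bipartiteAbove_eq_sum_card_bipartiteBelow (s := T) (t := S)
    (fun d R => d.1 ⊆ R.1 ∧ R.2 ⊆ d.2)
  -- Without a room coloured by its own index set, every room would have an even number of doors.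
  have heven : Even (∑ R ∈ S, #(T.bipartiteBelow (fun d R => d.1 ⊆ R.1 ∧ R.2 ⊆ d.2) R)) := by
    refine Finset.even_sum _ fun R hR => ?_
    obtain ⟨hdom, hcard⟩ := (mem_filter.1 hR).2
    have h := even_card_doors c i₀ hcard (hcon _ _ hdom hcard)
    refine (congrArg (fun A => Even #A) ?_).mpr h
    ext d
    simp only [bipartiteBelow, hT, mem_filter, mem_univ, true_and]
    constructor
    · rintro ⟨⟨-, h⟩, h'⟩
      exact ⟨h, h'⟩
    · rintro ⟨h, h'⟩
      exact ⟨⟨hdom.mono h'.1 h'.2, h⟩, h'⟩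
  have habove : ∀ d : Finset X × Finset I, S.bipartiteAbove (fun d R => d.1 ⊆ R.1 ∧ R.2 ⊆ d.2) d =
      IsDominant.rooms u d.1 d.2 := by
    intro d
    ext R
    simp [S, bipartiteAbove, IsDominant.mem_rooms, and_assoc]
  have hd₀ : ((∅ : Finset X), ({i₀} : Finset I)) ∈ T := by
    simp only [hT, mem_filter, mem_univ, true_and]
    exact ⟨fun y => ⟨i₀, by simp, by simp⟩, by simp, by simp, by simp⟩
  rw [← hcount, ← add_sum_erase _ _ hd₀, habove,
    IsDominant.card_rooms_empty hu] at heven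
  refine Nat.not_even_iff_odd.2 ?_ heven
  refine odd_one.add_even (Finset.even_sum _ fun d hd => ?_)
  obtain ⟨hne, hd⟩ := mem_erase.1 hd
  rw [habove]
  obtain ⟨h1, h2, h3, h4⟩ := (mem_filter.1 hd).2
  rw [IsDominant.card_rooms_of_nonempty hu h1 h2]
  · exact even_two
  · rw [nonempty_iff_ne_empty]
    intro he
    apply hne
    rw [he, card_empty, zero_add] at h2
    obtain ⟨k, hk⟩ := card_eq_one.1 h2
    rw [hk, mem_singleton] at h3
    exact Prod.ext he (by rw [hk, h3])

/-! ### Brouwer's theorem on the standard simplex -/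

open Filter Topology

open Finset in
/-- For every colouring of the lattice points of the dilated simplex of size `N` there is a lattice
point `a` such that every colour `i`, except where the coordinate `a i` is small, occurs near `a`.
The bound on "small" and "near" does not depend on `N`. -/
theorem exists_natPoints {I : Type*} [Fintype I] [Nonempty I] (N : ℕ) (c : (I → ℕ) → I) :
    ∃ a : I → ℕ, ∑ i, a i = N ∧ ∀ i, Fintype.card I < a i → ∃ b : I → ℕ, ∑ j, b j = N ∧ c b = i ∧
      ∀ j, a j ≤ b j + Fintype.card I ∧ b j ≤ a j + Fintype.card I := by
  classical
  let X := {a : I → ℕ // a ∈ piAntidiag univ N}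
  have : Fintype X := inferInstanceAs (Fintype (piAntidiag (univ : Finset I) N))
  have hX : ∀ a : X, ∑ i, a.1 i = N := fun a => (mem_piAntidiag.1 a.2).1
  have hmk : ∀ a : I → ℕ, ∑ i, a i = N → a ∈ piAntidiag univ N := fun a h =>
    mem_piAntidiag.2 ⟨h, fun i _ => mem_univ i⟩
  obtain ⟨i₀⟩ := ‹Nonempty I›
  have : Nonempty I := ⟨i₀⟩
  have : Nonempty X := ⟨⟨Pi.single i₀ N, hmk _ (by simp)⟩⟩
  let e := Fintype.equivFin X
  -- The `i`-th order compares `i`-th coordinates, ties being broken by an enumeration.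
  let u : I → X → ℕ ×ₗ Fin (Fintype.card X) := fun i a => toLex (a.1 i, e a)
  have hu : ∀ i, Function.Injective (u i) := by
    intro i a b hab
    exact e.injective (congrArg (fun z => (ofLex z).2) hab)
  have hule : ∀ i a b, u i a ≤ u i b → a.1 i ≤ b.1 i := by
    intro i a b hab
    rcases Prod.Lex.toLex_le_toLex.1 hab with h | h
    · exact h.le
    · exact h.1.le
  obtain ⟨σ, C, hdom, hcard, himg⟩ := IsDominant.exists_image_eq hu (fun a => c a.1)
  obtain ⟨k, hk, -⟩ := hdom (Classical.arbitrary X)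
  have hσ : σ.Nonempty := by
    rw [← card_pos, hcard, card_pos]; exact ⟨k, hk⟩
  choose m hmem hmin using fun i => σ.exists_min_image (fun a => a.1 i) hσ
  -- Otherwise some grid point would exceed all the minima over `σ` in the directions of `C`.
  have hsum : N < ∑ i ∈ C, (m i).1 i + #C := by
    by_contra! hle
    let y : I → ℕ := fun i => (if i ∈ C then (m i).1 i + 1 else 0) +
      Pi.single (M := fun _ => ℕ) k (N - (∑ i ∈ C, (m i).1 i + #C)) i
    have hy : ∑ i, y i = N := by
      simp only [y, sum_add_distrib, sum_ite_mem, univ_inter, sum_const, smul_eq_mul, mul_one,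
        sum_pi_single', mem_univ, if_true]
      omega
    obtain ⟨i, hi, hi'⟩ := hdom ⟨y, hmk y hy⟩
    have := hule _ _ _ (hi' (m i) (hmem i))
    simp only [y, hi, if_true] at this
    omega
  have hCn : #C ≤ Fintype.card I := card_le_univ C
  have hbd : ∀ a ∈ σ, (∀ i ∈ C, a.1 i ≤ (m i).1 i + Fintype.card I) ∧
      ∀ i ∉ C, a.1 i ≤ Fintype.card I := by
    intro a ha
    have h1 : ∑ i ∈ C, a.1 i + ∑ i ∈ Cᶜ, a.1 i = N := by rw [sum_add_sum_compl, hX]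
    have hle : ∀ i ∈ C, (m i).1 i ≤ a.1 i := fun i _ => hmin i a ha
    constructor
    · intro i hi
      have h2 := add_sum_erase C (fun i => a.1 i) hi
      have h3 := add_sum_erase C (fun i => (m i).1 i) hi
      have h4 := sum_le_sum fun j (hj : j ∈ C.erase i) => hle j (mem_of_mem_erase hj)
      omega
    · intro i hi
      have h2 := sum_le_sum hle
      have h3 := single_le_sum (f := fun i => a.1 i) (fun _ _ => Nat.zero_le _) (mem_compl.2 hi)
      omega
  obtain ⟨a, ha⟩ := hσ
  refine ⟨a.1, hX a, fun i hi => ?_⟩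
  have hiC : i ∈ C := by
    by_contra hc
    exact hi.not_ge ((hbd a ha).2 i hc)
  rw [← himg] at hiC
  obtain ⟨b, hb, hbi⟩ := mem_image.1 hiC
  refine ⟨b.1, hX b, hbi, fun j => ?_⟩
  by_cases hj : j ∈ C
  · have h1 := (hbd a ha).1 j hj
    have h2 := (hbd b hb).1 j hj
    have h3 := hmin j a ha
    have h4 := hmin j b hb
    omega
  · have h1 := (hbd a ha).2 j hj
    have h2 := (hbd b hb).2 j hj
    omega

/-- **Brouwer's fixed point theorem** for the standard simplex. -/
theorem stdSimplex.exists_fixedPoint {I : Type*} [Fintype I] [Nonempty I]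
    (f : stdSimplex ℝ I → stdSimplex ℝ I) (hf : Continuous f) : ∃ x, f x = x := by
  classical
  have hgrid : ∀ (N : ℕ) (a : I → ℕ), ∑ i, a i = N + 1 →
      (fun i => (a i : ℝ) / (N + 1)) ∈ stdSimplex ℝ I := by
    intro N a ha
    refine ⟨fun i => by positivity, ?_⟩
    rw [← Finset.sum_div, div_eq_one_iff_eq (by positivity)]
    exact_mod_cast ha
  -- Both points have coordinate sum `1`, so some coordinate does not decrease.
  have hcol : ∀ x : stdSimplex ℝ I, ∃ i, x.1 i ≤ (f x).1 i := by
    intro x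
    by_contra! h
    have := Finset.sum_lt_sum_of_nonempty Finset.univ_nonempty fun i _ => h i
    rw [(f x).2.2, x.2.2] at this
    exact this.false
  choose col hcol using hcol
  have happ : ∀ N : ℕ, ∃ p : stdSimplex ℝ I, ∀ i, ∃ q : stdSimplex ℝ I,
      dist q p ≤ Fintype.card I / ((N : ℝ) + 1) ∧
      q.1 i ≤ (f q).1 i + Fintype.card I / ((N : ℝ) + 1) := by
    intro N
    obtain ⟨a, ha, h⟩ := exists_natPoints (N + 1) (fun a : I → ℕ =>
      if h : ∑ i, a i = N + 1 then col ⟨_, hgrid N a h⟩ else Classical.arbitrary I)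
    refine ⟨⟨_, hgrid N a ha⟩, fun i => ?_⟩
    by_cases hi : Fintype.card I < a i
    · obtain ⟨b, hb, hbi, hbd⟩ := h i hi
      rw [dif_pos hb] at hbi
      refine ⟨⟨_, hgrid N b hb⟩, ?_, ?_⟩
      · rw [Subtype.dist_eq, dist_pi_le_iff (by positivity)]
        intro j
        rw [Real.dist_eq, ← sub_div, abs_div, abs_of_pos (show (0 : ℝ) < N + 1 by positivity)]
        gcongr
        have h1 : (a j : ℝ) ≤ b j + Fintype.card I := by exact_mod_cast (hbd j).1
        have h2 : (b j : ℝ) ≤ a j + Fintype.card I := by exact_mod_cast (hbd j).2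
        rw [abs_le]
        constructor <;> linarith
      · have := hcol ⟨_, hgrid N b hb⟩
        rw [hbi] at this
        exact this.trans (le_add_of_nonneg_right (by positivity))
    -- Where `a i` is small, the inequality holds up to the error term because `f` is nonnegative.
    · refine ⟨⟨_, hgrid N a ha⟩, by rw [dist_self]; positivity, ?_⟩
      have h1 := (f ⟨_, hgrid N a ha⟩).2.1 i
      have h2 : (a i : ℝ) / (N + 1) ≤ Fintype.card I / (N + 1) := by
        gcongr
        exact_mod_cast not_lt.1 hi
      dsimp only
      linarith
  choose p q hqp hq using happ
  have : CompactSpace (stdSimplex ℝ I) := isCompact_iff_compactSpace.1 (isCompact_stdSimplex ℝ I)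
  -- In the limit no coordinate decreases, and then none increases either.
  obtain ⟨x, φ, hφ, hx⟩ := CompactSpace.tendsto_subseq p
  have hε : Tendsto (fun n => (Fintype.card I : ℝ) / ((φ n : ℝ) + 1)) atTop (𝓝 0) :=
    (tendsto_const_div_atTop_nhds_zero_nat (Fintype.card I : ℝ)).comp
      ((tendsto_add_atTop_nat 1).comp hφ.tendsto_atTop) |>.congr fun n => by simp
  have hle : ∀ i, x.1 i ≤ (f x).1 i := by
    intro i
    have hqx : Tendsto (fun n => q (φ n) i) atTop (𝓝 x) := by
      rw [tendsto_iff_dist_tendsto_zero]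
      refine squeeze_zero (fun _ => dist_nonneg)
        (fun n => (dist_triangle _ (p (φ n)) _).trans (add_le_add_left (hqp _ _) _)) ?_
      simpa using hε.add (tendsto_iff_dist_tendsto_zero.1 hx)
    have hcoord : Continuous fun y : stdSimplex ℝ I => y.1 i :=
      (continuous_apply i).comp continuous_subtype_val
    have h1 := (hcoord.tendsto x).comp hqx
    have h2 := (((hcoord.comp hf).tendsto x).comp hqx).add hε
    rw [add_zero] at h2
    exact le_of_tendsto_of_tendsto' h1 h2 fun n => hq (φ n) i
  refine ⟨x, Subtype.ext (funext fun i => ?_)⟩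
  have := (Finset.sum_eq_sum_iff_of_le fun i _ => hle i).1 (by rw [x.2.2, (f x).2.2])
  exact (this i (Finset.mem_univ i)).symm

/-! ### Fixed points in locally convex spaces -/

/-- A continuous self-map of a compact convex set moves some point by an element of a prescribed
convex neighbourhood of `0`. A partition of unity subordinate to finitely many translates of that
neighbourhood turns the map into a self-map of a standard simplex. -/
theorem exists_sub_mem_of_convex {X : Type*} [AddCommGroup X] [Module ℝ X] [TopologicalSpace X]
    [IsTopologicalAddGroup X] [ContinuousSMul ℝ X] [T2Space X]
    {K : Set X} (hne : K.Nonempty) (hcpt : IsCompact K) (hconv : Convex ℝ K)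
    (f : K → K) (hf : Continuous f) {V : Set X} (hV : V ∈ 𝓝 0) (hVc : Convex ℝ V) :
    ∃ x : K, (f x : X) - x ∈ V := by
  have : CompactSpace K := isCompact_iff_compactSpace.1 hcpt
  have : Nonempty K := hne.to_subtype
  let U : K → Set K := fun y => {z | (z : X) - y ∈ interior V}
  have hU : ∀ y, IsOpen (U y) := fun y =>
    isOpen_interior.preimage (continuous_subtype_val.sub continuous_const)
  obtain ⟨t, -, ht⟩ := isCompact_univ.elim_nhds_subcover U fun y _ =>
    (hU y).mem_nhds (by simpa [U] using mem_interior_iff_mem_nhds.2 hV)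
  have htU : (Set.univ : Set K) ⊆ ⋃ y : t, U y := by
    intro z hz
    obtain ⟨y, hy, hz'⟩ := Set.mem_iUnion₂.1 (ht hz)
    exact Set.mem_iUnion.2 ⟨⟨y, hy⟩, hz'⟩
  obtain ⟨φ, hφ⟩ := PartitionOfUnity.exists_isSubordinate isClosed_univ (fun y : t => U y)
    (fun y => hU y) htU
  have hsum : ∀ z, ∑ y, φ y z = 1 := fun z => by
    rw [← finsum_eq_sum_of_fintype, φ.sum_eq_one (Set.mem_univ z)]
  have : Nonempty t := by
    by_contra! h
    simpa using hsum (Classical.arbitrary K)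
  let h : stdSimplex ℝ t → K := fun s => ⟨∑ y, s.1 y • ((y : K) : X),
    hconv.sum_mem (fun y _ => s.2.1 y) s.2.2 fun y _ => (y : K).2⟩
  have hh : Continuous h := by
    refine Continuous.subtype_mk (continuous_finsetSum _ fun y _ => ?_) _
    exact ((continuous_apply y).comp continuous_subtype_val).smul continuous_const
  let g : stdSimplex ℝ t → stdSimplex ℝ t := fun s =>
    ⟨fun y => φ y (f (h s)), fun y => φ.nonneg y _, hsum _⟩
  have hg : Continuous g := by
    refine Continuous.subtype_mk (continuous_pi fun y => ?_) _
    exact (φ y).continuous.comp (hf.comp hh)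
  obtain ⟨s, hs⟩ := stdSimplex.exists_fixedPoint g hg
  have hs' : ∀ y, φ y (f (h s)) = s.1 y := fun y => congrFun (congrArg Subtype.val hs) y
  refine ⟨h s, ?_⟩
  have hdiff : (f (h s) : X) - h s = ∑ᶠ y, s.1 y • ((f (h s) : X) - (y : K)) := by
    rw [finsum_eq_sum_of_fintype]
    simp only [smul_sub, Finset.sum_sub_distrib, ← Finset.sum_smul, s.2.2, one_smul, h]
  rw [hdiff]
  refine hVc.finsum_mem s.2.1 (by rw [finsum_eq_sum_of_fintype, s.2.2]) fun y hy => ?_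
  refine interior_subset (hφ y (subset_tsupport _ ?_) : f (h s) ∈ U y)
  rw [Function.mem_support, hs']
  exact hy

/-- **The Schauder–Tychonoff fixed point theorem.** -/
theorem exists_fixedPoint_of_isCompact_convex {X : Type*} [AddCommGroup X] [Module ℝ X]
    [TopologicalSpace X] [IsTopologicalAddGroup X] [ContinuousSMul ℝ X] [LocallyConvexSpace ℝ X]
    [T2Space X] {K : Set X} (hne : K.Nonempty) (hcpt : IsCompact K) (hconv : Convex ℝ K)
    (f : K → K) (hf : Continuous f) : ∃ x, f x = x := by
  have : CompactSpace K := isCompact_iff_compactSpace.1 hcpt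
  by_contra! h
  have hclosed : IsClosed (Set.range fun x : K => (f x : X) - x) :=
    (isCompact_range ((continuous_subtype_val.comp hf).sub continuous_subtype_val)).isClosed
  have h0 : (Set.range fun x : K => (f x : X) - x)ᶜ ∈ 𝓝 (0 : X) := by
    refine hclosed.isOpen_compl.mem_nhds ?_
    rintro ⟨x, hx⟩
    exact h x (Subtype.ext (sub_eq_zero.1 hx))
  obtain ⟨V, ⟨hV, hVc⟩, hVsub⟩ := (LocallyConvexSpace.convex_basis_zero ℝ X).mem_iff.1 h0
  obtain ⟨x, hx⟩ := exists_sub_mem_of_convex hne hcpt hconv f hf hV hVc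
  exact hVsub hx ⟨x, rfl⟩

theorem theorem1p1 {X : Type*} [AddCommGroup X] [Module ℝ X] [TopologicalSpace X]
    [IsTopologicalAddGroup X] [ContinuousSMul ℝ X] [LocallyConvexSpace ℝ X] [T2Space X]
    (K : Set X) (hK_nonempty : K.Nonempty) (hK_compact : IsCompact K) (hK_convex : Convex ℝ K)
    (f : K → K) (hf : Continuous f) (hf_ne_id : f ≠ id) :
    ∃ p : K, ∃ x : Set.Ioc (0 : ℝ) 1 → K, Function.Injective x ∧
      ∀ t : Set.Ioc (0 : ℝ) 1,
        (f (x t) : X) = (p : X) + (1 / (t : ℝ)) • ((x t : X) - (p : X)) := by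
  obtain ⟨p, hp⟩ := Function.ne_iff.1 hf_ne_id
  have hfix : ∀ t : Set.Ioc (0 : ℝ) 1, ∃ x : K,
      (t : ℝ) • (f x : X) + (1 - (t : ℝ)) • (p : X) = x := by
    intro t
    obtain ⟨x, hx⟩ := exists_fixedPoint_of_isCompact_convex hK_nonempty hK_compact hK_convex
      (fun x => ⟨(t : ℝ) • (f x : X) + (1 - (t : ℝ)) • (p : X),
        hK_convex (f x).2 p.2 t.2.1.le (sub_nonneg.2 t.2.2) (by ring)⟩) (by fun_prop)
    exact ⟨x, congrArg Subtype.val hx⟩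
  choose x hx using hfix
  have hsub : ∀ t, (x t : X) - p = (t : ℝ) • ((f (x t) : X) - p) := by
    intro t
    nth_rw 1 [← hx t]
    module
  refine ⟨p, x, fun s t hst => ?_, fun t => ?_⟩
  · by_contra hne
    have h := (hsub s).symm.trans (hst ▸ hsub t)
    have hfx : (f (x s) : X) - p = 0 := by
      rw [← sub_eq_zero, ← sub_smul] at h
      exact (smul_eq_zero.1 h).resolve_left (sub_ne_zero.2 fun e => hne (Subtype.ext e))
    -- If `x s = x t`, this point is `p` itself, which would then be fixed by `f`.
    have hxp : x s = p := Subtype.ext (sub_eq_zero.1 (by rw [hsub s, hfx, smul_zero]))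
    exact hp (Subtype.ext (by rw [hxp] at hfx; exact sub_eq_zero.1 hfx))
  · rw [hsub t, smul_smul, one_div, inv_mul_cancel₀ t.2.1.ne', one_smul]
    abel
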